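/- Let $(G,+)$ be an Abelian, Hausdorff, locally compact, second-countable topological group with Haar measure $\lambda_G$. Let $\mathrm M(G)$ be the space of Borel measures on $G$ that are finite on compact sets, with the $\sigma$-algebra $\mathcal M(G)$ generated by the maps $\xi\mapsto\xi(K)$, $K\subset G$ compact, and let $\emptyset$ denote the zero measure. For $t\in G$ let $\tau_t:\mathrm M(G)\to\mathrm M(G)$, $\tau_t\xi=\xi(\,\cdot+t)$. An event $A\in\mathcal M(G)$ is called $\tau$-invariant if $\tau_tA=A$ for all $t\in G$. Let $\mathrm P$ be a $\sigma$-finite measure on $\mathrm M(G)$ with $\mathrm P(\{\emptyset\})=0$ that is stationary, i.e. the image of $\mathrm P$ under $\tau_t$ is $\mathrm P$ for all $t\in G$. Let $\mathrm P_0$ be its Palm measure, $$\mathrm P_0(A)=\int_{\mathrm M(G)}\int_G\omega(t)\,\mathbf 1(\tau_t\xi\in A)\,\xi(\mathrm dt)\,\mathrm P(\mathrm d\xi),\qquad A\in\mathcal M(G),$$ where $\omega\ge 0$ is any measurable function on $G$ with $\int_G\omega\,\mathrm d\lambda_G=1$. On $\mathrm M(G)\times G$ with the product $\sigma$-algebra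 consider the measure $\mathrm Q(\mathrm d\xi,\mathrm dt)=\mathrm P_0(\mathrm d\xi)\,\xi(\mathrm dt)$ and the map $\rho(\xi,t)=(\tau_t\xi,-t)$. For every such $\omega$, the following are equivalent. 1. $\mathrm P$ is ergodic, i.e. $\mathrm P$ is stationary and every $\tau$-invariant event $A\in\mathcal M(G)$ satisfies $\mathrm P(A)=0$ or $\mathrm P(A^c)=0$. 2. Every $\tau$-invariant event $A\in\mathcal M(G)$ satisfies $\mathrm P_0(A)=0$ or $\mathrm P_0(A^c)=0$. 3. The discrete dynamical system $(\mathrm M(G)\times G,\{A\times G:A\in\mathcal M(G)\},\mathrm Q,\rho)$ is ergodic, i.e. $\rho$ preserves $\mathrm Q$, and every set $E=A\times G$ with $A\in\mathcal M(G)$ and $\rho^{-1}(E)=E$ satisfies $\mathrm Q(E)=0$ or $\mathrm Q(E^c)=0$. -/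

import Mathlib

open MeasureTheory ProbabilityTheory
open scoped ENNReal

set_option linter.unusedSectionVars false

noncomputable section

/-- The space `M(G)` of measures on `G` that are finite on compact sets. -/
def LocFinMeasure (G : Type*) [TopologicalSpace G] [MeasurableSpace G] : Type _ :=
  {ξ : Measure G // ∀ K : Set G, IsCompact K → ξ K < ∞}

namespace LocFinMeasure

section Space

variable {G : Type*} [TopologicalSpace G] [MeasurableSpace G]

/-- The underlying measure. -/
def toMeasure (ξ : LocFinMeasure G) : Measure G := ξ.1

theorem measure_lt_top (ξ : LocFinMeasure G) {K : Set G} (hK : IsCompact K) :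
    ξ.toMeasure K < ∞ := ξ.2 K hK

/-- The `σ`-algebra on `M(G)` generated by the maps `ξ ↦ ξ(K)`, `K` compact. -/
instance instMeasurableSpace : MeasurableSpace (LocFinMeasure G) :=
  ⨆ (K : Set G) (_ : IsCompact K),
    MeasurableSpace.comap (fun ξ : LocFinMeasure G => ξ.toMeasure K) (borel ℝ≥0∞)

/-- The zero measure. -/
instance instZero : Zero (LocFinMeasure G) := ⟨⟨0, fun _ _ => by simp⟩⟩

theorem measurable_apply_compact {K : Set G} (hK : IsCompact K) :
    Measurable (fun ξ : LocFinMeasure G => ξ.toMeasure K) := by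
  have h : MeasurableSpace.comap (fun ξ : LocFinMeasure G => ξ.toMeasure K) (borel ℝ≥0∞)
      ≤ (instMeasurableSpace : MeasurableSpace (LocFinMeasure G)) :=
    le_iSup₂_of_le (f := fun (K : Set G) (_ : IsCompact K) =>
      MeasurableSpace.comap (fun ξ : LocFinMeasure G => ξ.toMeasure K) (borel ℝ≥0∞))
      K hK le_rfl
  rw [measurable_iff_comap_le, BorelSpace.measurable_eq (α := ℝ≥0∞)]
  exact h

theorem measurable_of_compact {X : Type*} [MeasurableSpace X] {f : X → LocFinMeasure G}
    (hf : ∀ K : Set G, IsCompact K → Measurable (fun x => (f x).toMeasure K)) :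
    Measurable f := by
  rw [measurable_iff_comap_le]
  change MeasurableSpace.comap f (⨆ (K : Set G) (_ : IsCompact K), _) ≤ _
  simp only [MeasurableSpace.comap_iSup, MeasurableSpace.comap_comp]
  refine iSup₂_le fun K hK => ?_
  have h := hf K hK
  rw [measurable_iff_comap_le, BorelSpace.measurable_eq (α := ℝ≥0∞)] at h
  exact h

end Space

section Kernel

variable {G : Type*} [TopologicalSpace G] [LocallyCompactSpace G] [T2Space G]
  [SecondCountableTopology G] [MeasurableSpace G] [BorelSpace G]

theorem measurable_restrict {K : Set G} (hK : IsCompact K) :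
    Measurable (fun ξ : LocFinMeasure G => ξ.toMeasure.restrict K) := by
  have hfin : ∀ ξ : LocFinMeasure G, IsFiniteMeasure (ξ.toMeasure.restrict K) := fun ξ =>
    ⟨by simpa using ξ.measure_lt_top hK⟩
  refine Measurable.measure_of_isPiSystem (S := {s | IsClosed s}) ?_ isPiSystem_isClosed ?_ ?_
  · rw [BorelSpace.measurable_eq (α := G), borel_eq_generateFrom_isClosed]
  · intro s hs
    simp only [Measure.restrict_apply (IsClosed.measurableSet hs)]
    exact measurable_apply_compact (hK.inter_left hs)
  · simpa using measurable_apply_compact hK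

theorem measurable_toMeasure :
    Measurable (toMeasure : LocFinMeasure G → Measure G) := by
  refine Measure.measurable_of_measurable_coe _ fun s hs => ?_
  have h : ∀ ξ : LocFinMeasure G,
      ξ.toMeasure s = ⨆ n, ξ.toMeasure.restrict (compactCovering G n) s := by
    intro ξ
    simp only [Measure.restrict_apply hs]
    rw [← Monotone.measure_iUnion
      (fun m n hmn => Set.inter_subset_inter_right s (compactCovering_subset G hmn)),
      ← Set.inter_iUnion, iUnion_compactCovering, Set.inter_univ]
  simp only [h]
  exact Measurable.iSup fun n =>
    (Measure.measurable_coe hs).comp (measurable_restrict (isCompact_compactCovering G n))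

/-- The tautological kernel `ξ ↦ ξ(dt)` from `M(G)` to `G`. -/
def kernel (G : Type*) [TopologicalSpace G] [LocallyCompactSpace G] [T2Space G]
    [SecondCountableTopology G] [MeasurableSpace G] [BorelSpace G] :
    Kernel (LocFinMeasure G) G where
  toFun := toMeasure
  measurable' := measurable_toMeasure

instance instIsSFiniteKernel : IsSFiniteKernel (kernel G) := by
  classical
  have hD : ∀ n, MeasurableSet (disjointed (compactCovering G) n) := fun n =>
    MeasurableSet.disjointed (fun i => (isCompact_compactCovering G i).measurableSet) n
  have hlt : ∀ (ξ : LocFinMeasure G) n, ξ.toMeasure (compactCovering G n) < ∞ := fun ξ n =>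
    ξ.measure_lt_top (isCompact_compactCovering G n)
  let S : ℕ → ℕ → Set (LocFinMeasure G) := fun n m =>
    {ξ | ⌊(ξ.toMeasure (compactCovering G n)).toNNReal⌋₊ = m}
  have hS : ∀ n m, MeasurableSet (S n m) := fun n m => by
    have h : Measurable fun ξ : LocFinMeasure G =>
        ⌊(ξ.toMeasure (compactCovering G n)).toNNReal⌋₊ :=
      Nat.measurable_floor.comp
        (measurable_apply_compact (isCompact_compactCovering G n)).ennreal_toNNReal
    exact h (measurableSet_singleton m)
  let κ : ℕ → ℕ → Kernel (LocFinMeasure G) G := fun n m =>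
    Kernel.piecewise (hS n m) ((kernel G).restrict (hD n)) 0
  have hκ : ∀ n m, IsFiniteKernel (κ n m) := fun n m => by
    refine ⟨⟨(m : ℝ≥0∞) + 1, by finiteness, fun ξ => ?_⟩⟩
    simp only [κ, Kernel.piecewise_apply]
    split_ifs with h
    · rw [Kernel.restrict_apply, Measure.restrict_apply MeasurableSet.univ, Set.univ_inter]
      refine (measure_mono (disjointed_subset _ n)).trans ?_
      change ξ.toMeasure (compactCovering G n) ≤ _
      have h2 := (Nat.lt_floor_add_one (ξ.toMeasure (compactCovering G n)).toNNReal).le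
      rw [show ⌊(ξ.toMeasure (compactCovering G n)).toNNReal⌋₊ = m from h] at h2
      rw [← ENNReal.coe_toNNReal (hlt ξ n).ne]
      exact_mod_cast h2
    · simp
  have hsum : kernel G = Kernel.sum fun n => Kernel.sum fun m => κ n m := by
    ext ξ s hs
    rw [Kernel.sum_apply' _ _ hs]
    have h1 : ∀ n, (Kernel.sum fun m => κ n m) ξ s
        = ξ.toMeasure (s ∩ disjointed (compactCovering G) n) := by
      intro n
      rw [Kernel.sum_apply' _ _ hs,
        tsum_eq_single ⌊(ξ.toMeasure (compactCovering G n)).toNNReal⌋₊]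
      · have h3 : ξ ∈ S n ⌊(ξ.toMeasure (compactCovering G n)).toNNReal⌋₊ := rfl
        simp only [κ, Kernel.piecewise_apply, if_pos h3, Kernel.restrict_apply,
          Measure.restrict_apply hs]
        rfl
      · intro m hm
        have h3 : ξ ∉ S n m := fun h => hm (Eq.symm h)
        simp [κ, Kernel.piecewise_apply, if_neg h3]
    simp only [h1]
    rw [← measure_iUnion _ fun n => hs.inter (hD n), ← Set.inter_iUnion, iUnion_disjointed,
      iUnion_compactCovering, Set.inter_univ]
    · rfl
    · intro i j hij
      exact (disjoint_disjointed (compactCovering G) hij).mono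
        Set.inter_subset_right Set.inter_subset_right
  rw [hsum]
  have : ∀ n, IsSFiniteKernel (Kernel.sum fun m => κ n m) := fun n => inferInstance
  infer_instance

/-- The measure `P(dξ) ξ(dt)` on `M(G) × G`. -/
def campbell (P : Measure (LocFinMeasure G)) : Measure (LocFinMeasure G × G) :=
  P ⊗ₘ kernel G

theorem campbell_apply (P : Measure (LocFinMeasure G)) [SFinite P]
    {E : Set (LocFinMeasure G × G)} (hE : MeasurableSet E) :
    campbell P E = ∫⁻ ξ, ξ.toMeasure {t | (ξ, t) ∈ E} ∂P :=
  Measure.compProd_apply hE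

end Kernel

section Group

variable {G : Type*} [AddCommGroup G] [TopologicalSpace G] [IsTopologicalAddGroup G]
  [LocallyCompactSpace G] [T2Space G] [SecondCountableTopology G]
  [MeasurableSpace G] [BorelSpace G]

/-- The translation `τ_t ξ = ξ(· + t)`, i.e. the image of `ξ` under `s ↦ s - t`. -/
def translate (t : G) (ξ : LocFinMeasure G) : LocFinMeasure G :=
  ⟨ξ.toMeasure.map (fun s => s - t), fun K hK => by
    rw [Measure.map_apply (by fun_prop) hK.measurableSet]
    have h : (fun s => s - t) ⁻¹' K = (fun s => s + t) '' K := by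
      ext s
      simp only [Set.mem_preimage, Set.mem_image]
      exact ⟨fun h => ⟨s - t, h, by simp⟩, by rintro ⟨u, hu, rfl⟩; simpa using hu⟩
    rw [h]
    exact ξ.measure_lt_top (hK.image (by fun_prop))⟩

theorem measurable_translate :
    Measurable (fun p : LocFinMeasure G × G => translate p.2 p.1) := by
  refine measurable_of_compact fun K hK => ?_
  have h : ∀ p : LocFinMeasure G × G, (translate p.2 p.1).toMeasure K
      = (kernel G).prodMkRight G p {s | s - p.2 ∈ K} := fun p => by
    change (p.1.toMeasure.map (fun s => s - p.2)) K = _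
    rw [Measure.map_apply (by fun_prop) hK.measurableSet]
    rfl
  simp only [h]
  have hm : MeasurableSet {q : (LocFinMeasure G × G) × G | q.2 - q.1.2 ∈ K} :=
    (show Measurable fun q : (LocFinMeasure G × G) × G => q.2 - q.1.2 by fun_prop)
      hK.measurableSet
  exact Kernel.measurable_kernel_prodMk_left hm

/-- `A ⊆ M(G)` is `τ`-invariant: `τ_t A = A` for all `t`. -/
def IsInvariant (A : Set (LocFinMeasure G)) : Prop :=
  ∀ t : G, translate t '' A = A

/-- `P` is stationary: the image of `P` under every translation `τ_t` is `P`. -/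
def IsStationary (P : Measure (LocFinMeasure G)) : Prop :=
  ∀ t : G, P.map (translate t) = P

/-- `P` is ergodic: it is stationary and every `τ`-invariant event is null or co-null. -/
structure IsErgodic (P : Measure (LocFinMeasure G)) : Prop where
  stationary : IsStationary P
  null_or_conull : ∀ A : Set (LocFinMeasure G), MeasurableSet A → IsInvariant A →
    P A = 0 ∨ P Aᶜ = 0

/-- The Palm measure
`P₀(A) = ∫ ∫ ω(t) 1(τ_t ξ ∈ A) ξ(dt) P(dξ)`, see `palm_apply`. For stationary `P` it does not
depend on the weight `ω`, as long as `ω` has integral one with respect to the Haar measure. -/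
def palm (ω : G → ℝ≥0∞) (P : Measure (LocFinMeasure G)) : Measure (LocFinMeasure G) :=
  ((campbell P).withDensity fun p => ω p.2).map fun p => translate p.2 p.1

theorem palm_apply {ω : G → ℝ≥0∞} (hω : Measurable ω) (P : Measure (LocFinMeasure G))
    [SFinite P] {A : Set (LocFinMeasure G)} (hA : MeasurableSet A) :
    palm ω P A
      = ∫⁻ ξ, ∫⁻ t, ω t * A.indicator 1 (translate t ξ) ∂ξ.toMeasure ∂P := by
  have hA' : MeasurableSet ((fun p : LocFinMeasure G × G => translate p.2 p.1) ⁻¹' A) :=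
    measurable_translate hA
  have hω' : Measurable fun p : LocFinMeasure G × G => ω p.2 := hω.comp measurable_snd
  rw [palm, Measure.map_apply measurable_translate hA, withDensity_apply _ hA',
    ← lintegral_indicator hA', campbell, Measure.lintegral_compProd (hω'.indicator hA')]
  refine lintegral_congr fun ξ => lintegral_congr fun t => ?_
  by_cases h : translate t ξ ∈ A <;> simp [Set.indicator, h]

instance instSFinitePalm (ω : G → ℝ≥0∞) (P : Measure (LocFinMeasure G)) :
    SFinite (palm ω P) := by
  unfold palm campbell
  infer_instance

/-- The map `ρ(ξ, t) = (τ_t ξ, -t)` on `M(G) × G`. -/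
def rho (p : LocFinMeasure G × G) : LocFinMeasure G × G :=
  (translate p.2 p.1, -p.2)

end Group

/-- The `σ`-algebra `{A × G : A ∈ 𝓜(G)}` on `M(G) × G`. -/
abbrev cylinders (G : Type*) [TopologicalSpace G] [MeasurableSpace G] :
    MeasurableSpace (LocFinMeasure G × G) :=
  MeasurableSpace.comap Prod.fst instMeasurableSpace

theorem measurableSet_cylinders_iff {G : Type*} [TopologicalSpace G] [MeasurableSpace G]
    {E : Set (LocFinMeasure G × G)} :
    MeasurableSet[cylinders G] E ↔
      ∃ A : Set (LocFinMeasure G), MeasurableSet A ∧ A ×ˢ Set.univ = E := by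
  simp only [Set.prod_univ]
  exact Iff.rfl

end LocFinMeasure

/-- The discrete dynamical system `(X, 𝓐, Q, T)` is ergodic, where `Q` is a measure on `X` and
`𝓐` is a `σ`-algebra possibly smaller than the one on which `Q` lives: `T` preserves `Q`, and
every `T`-invariant event of `𝓐` is null or co-null. The map `T` need not be `𝓐`-measurable. -/
structure IsErgodicSystem {X : Type*} (𝓐 : MeasurableSpace X) [MeasurableSpace X]
    (Q : Measure X) (T : X → X) : Prop where
  measurePreserving : MeasurePreserving T Q Q
  null_or_conull : ∀ E : Set X, MeasurableSet[𝓐] E → T ⁻¹' E = E → Q E = 0 ∨ Q Eᶜ = 0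

end

/-!
For an invariant event `A`, the Palm measure satisfies `P₀(A) = ∫_A ξ(ω) P(dξ)`, so `P(A) = 0`
implies `P₀(A) = 0`. Averaging this identity over all translates of `ω` gives
`λ(G) P₀(A) = ∫_A ξ(G) P(dξ)` (`haar_univ_mul_palm`). Since `P` does not charge the zero measure,
`P₀(A) = 0` therefore forces `P(A) = 0`. Thus `P` and `P₀` have the same invariant null sets, and
invariant events are closed under complements: this is the equivalence of the first two assertions.

The cylinder `A × G` is `ρ`-invariant exactly when `A` is `τ`-invariant
(`rho_preimage_prod_univ_eq_iff`), and `Q(A × G) = ∫_A ξ(G) P₀(dξ)` vanishes exactly when `P₀(A)`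
does, as `P₀` does not charge the zero measure either. It remains to see that `ρ` always preserves
`Q`. This is an instance of the exchange formula (`lintegral_exchange`)
`∫∫∫ ω(s) f(τ_u ξ, s - u) ξ(du) ξ(ds) P(dξ) = ∫∫∫ ω(u) f(τ_u ξ, s - u) ξ(du) ξ(ds) P(dξ)`,
proved by inserting `1 = ∫ ω(u + v) λ(dv)` on the left, translating `ξ` by `v`, which `P` does not
notice, and then integrating out `v` in `∫ ω(s - v) λ(dv) = 1`.
-/

namespace LocFinMeasure

open Set

section Palm

variable {G : Type*} [AddCommGroup G] [TopologicalSpace G] [IsTopologicalAddGroup G]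
  [LocallyCompactSpace G] [T2Space G] [SecondCountableTopology G]
  [MeasurableSpace G] [BorelSpace G]

/-! ### Integration against a locally finite measure and its translates -/

instance instSFiniteToMeasure (ξ : LocFinMeasure G) : SFinite ξ.toMeasure :=
  inferInstanceAs (SFinite (kernel G ξ))

theorem measurable_lintegral_toMeasure {X : Type*} [MeasurableSpace X]
    {g : X → LocFinMeasure G} (hg : Measurable g) {f : X → G → ℝ≥0∞}
    (hf : Measurable (Function.uncurry f)) :
    Measurable fun x => ∫⁻ t, f x t ∂(g x).toMeasure :=
  Measurable.lintegral_kernel_prod_right (κ := (kernel G).comap g hg) hf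

theorem lintegral_translate (s : G) (ξ : LocFinMeasure G) {f : G → ℝ≥0∞} (hf : Measurable f) :
    ∫⁻ t, f t ∂(translate s ξ).toMeasure = ∫⁻ t, f (t - s) ∂ξ.toMeasure :=
  lintegral_map hf (by fun_prop)

theorem translate_translate (s t : G) (ξ : LocFinMeasure G) :
    translate s (translate t ξ) = translate (t + s) ξ := by
  apply Subtype.ext
  change (ξ.toMeasure.map (fun u => u - t)).map (fun u => u - s)
    = ξ.toMeasure.map (fun u => u - (t + s))
  rw [Measure.map_map (by fun_prop) (by fun_prop)]
  congr 1
  ext u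
  simp [sub_sub]

theorem translate_zero (ξ : LocFinMeasure G) : translate 0 ξ = ξ := by
  apply Subtype.ext
  change ξ.toMeasure.map (fun u => u - 0) = ξ.toMeasure
  simp

theorem measurable_translate_left (t : G) :
    Measurable (translate t : LocFinMeasure G → LocFinMeasure G) :=
  measurable_translate.comp (measurable_id.prodMk measurable_const)

theorem toMeasure_univ_eq_zero_iff {ξ : LocFinMeasure G} : ξ.toMeasure univ = 0 ↔ ξ = 0 := by
  rw [Measure.measure_univ_eq_zero]
  exact ⟨fun h => Subtype.ext h, fun h => h ▸ rfl⟩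

theorem measurable_toMeasure_univ :
    Measurable fun ξ : LocFinMeasure G => ξ.toMeasure univ :=
  (Measure.measurable_coe MeasurableSet.univ).comp measurable_toMeasure

/-- A measure on `M(G)` that does not charge the zero measure is tested on events by the total
mass. -/
theorem setLIntegral_toMeasure_univ_eq_zero_iff {P : Measure (LocFinMeasure G)} (hP : P {0} = 0)
    {A : Set (LocFinMeasure G)} (hA : MeasurableSet A) :
    ∫⁻ ξ in A, ξ.toMeasure univ ∂P = 0 ↔ P A = 0 := by
  refine ⟨fun h => ?_, fun h => setLIntegral_measure_zero A _ h⟩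
  rw [setLIntegral_eq_zero_iff hA measurable_toMeasure_univ] at h
  refine measure_mono_null (fun ξ hξ => ?_) (measure_union_null (ae_iff.1 h) hP)
  by_cases h0 : ξ = 0
  · exact Or.inr h0
  · exact Or.inl fun h1 => h0 (toMeasure_univ_eq_zero_iff.1 (h1 hξ))

/-! ### Invariant events -/

theorem isInvariant_iff {A : Set (LocFinMeasure G)} :
    IsInvariant A ↔ ∀ (t : G) (ξ : LocFinMeasure G), translate t ξ ∈ A ↔ ξ ∈ A := by
  refine ⟨fun h t ξ => ⟨fun hξ => ?_, fun hξ => ?_⟩, fun h t => ?_⟩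
  · rw [← h (-t)]
    exact ⟨_, hξ, by simp [translate_translate, translate_zero]⟩
  · rw [← h t]
    exact ⟨ξ, hξ, rfl⟩
  · ext ξ
    refine ⟨?_, fun hξ => ⟨translate (-t) ξ, (h _ _).2 hξ, ?_⟩⟩
    · rintro ⟨η, hη, rfl⟩
      exact (h t η).2 hη
    · simp [translate_translate, translate_zero]

theorem IsInvariant.compl {A : Set (LocFinMeasure G)} (hA : IsInvariant A) : IsInvariant Aᶜ :=
  isInvariant_iff.2 fun t ξ => not_congr (isInvariant_iff.1 hA t ξ)

theorem isInvariant_singleton_zero : IsInvariant ({0} : Set (LocFinMeasure G)) := by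
  refine isInvariant_iff.2 fun t ξ => ?_
  simp only [mem_singleton_iff, ← toMeasure_univ_eq_zero_iff]
  change ξ.toMeasure.map (fun s => s - t) univ = 0 ↔ _
  rw [Measure.map_apply (by fun_prop) MeasurableSet.univ, preimage_univ]

theorem measurableSet_singleton_zero : MeasurableSet ({0} : Set (LocFinMeasure G)) := by
  convert measurable_toMeasure_univ (G := G) (measurableSet_singleton (0 : ℝ≥0∞)) using 1
  ext ξ
  exact toMeasure_univ_eq_zero_iff.symm

theorem rho_preimage_prod_univ_eq_iff {A : Set (LocFinMeasure G)} :
    rho ⁻¹' (A ×ˢ (univ : Set G)) = A ×ˢ univ ↔ IsInvariant A := by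
  simp only [isInvariant_iff, Set.ext_iff, Prod.forall, mem_preimage, rho, mem_prod, mem_univ,
    and_true]
  exact forall_comm

/-! ### Integrals of the Campbell and Palm measures -/

theorem lintegral_campbell (P : Measure (LocFinMeasure G)) [SFinite P]
    {f : LocFinMeasure G × G → ℝ≥0∞} (hf : Measurable f) :
    ∫⁻ p, f p ∂campbell P = ∫⁻ ξ, ∫⁻ t, f (ξ, t) ∂ξ.toMeasure ∂P :=
  Measure.lintegral_compProd hf

theorem campbell_prod_univ (P : Measure (LocFinMeasure G)) [SFinite P]
    {A : Set (LocFinMeasure G)} (hA : MeasurableSet A) :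
    campbell P (A ×ˢ univ) = ∫⁻ ξ in A, ξ.toMeasure univ ∂P := by
  rw [campbell_apply P (hA.prod MeasurableSet.univ), ← lintegral_indicator hA]
  refine lintegral_congr fun ξ => ?_
  by_cases h : ξ ∈ A <;> simp [h]

theorem lintegral_palm {ω : G → ℝ≥0∞} (hω : Measurable ω) (P : Measure (LocFinMeasure G))
    [SFinite P] {f : LocFinMeasure G → ℝ≥0∞} (hf : Measurable f) :
    ∫⁻ ξ, f ξ ∂palm ω P = ∫⁻ ξ, ∫⁻ t, ω t * f (translate t ξ) ∂ξ.toMeasure ∂P := by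
  have hω' : Measurable fun p : LocFinMeasure G × G => ω p.2 := hω.comp measurable_snd
  have hf' : Measurable fun p : LocFinMeasure G × G => f (translate p.2 p.1) :=
    hf.comp measurable_translate
  rw [palm, lintegral_map hf measurable_translate,
    lintegral_withDensity_eq_lintegral_mul _ hω' hf', lintegral_campbell P (hω'.mul hf')]
  rfl

theorem palm_apply_of_isInvariant {ω : G → ℝ≥0∞} (hω : Measurable ω)
    (P : Measure (LocFinMeasure G)) [SFinite P] {A : Set (LocFinMeasure G)}
    (hA : MeasurableSet A) (hinv : IsInvariant A) :
    palm ω P A = ∫⁻ ξ in A, ∫⁻ t, ω t ∂ξ.toMeasure ∂P := by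
  rw [palm_apply hω P hA, ← lintegral_indicator hA]
  refine lintegral_congr fun ξ => ?_
  by_cases h : ξ ∈ A <;> simp [indicator, isInvariant_iff.1 hinv, h]

theorem IsStationary.lintegral_translate_eq {P : Measure (LocFinMeasure G)} (hP : IsStationary P)
    (t : G) {f : LocFinMeasure G → ℝ≥0∞} (hf : Measurable f) :
    ∫⁻ ξ, f (translate t ξ) ∂P = ∫⁻ ξ, f ξ ∂P := by
  conv_rhs => rw [← hP t]
  exact (lintegral_map hf (measurable_translate_left t)).symm

/-! ### Haar measure and averaging over translations -/

theorem isNegInvariant_of_isAddHaarMeasure (haar : Measure G) [haar.IsAddHaarMeasure] :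
    haar.IsNegInvariant := by
  -- A metric is only needed for the regularity of Borel measures on metrizable spaces.
  let _ := TopologicalSpace.metrizableSpaceMetric G
  infer_instance

theorem lintegral_const_sub (haar : Measure G) [haar.IsAddHaarMeasure] (ω : G → ℝ≥0∞) (s : G) :
    ∫⁻ v, ω (s - v) ∂haar = ∫⁻ v, ω v ∂haar := by
  have := isNegInvariant_of_isAddHaarMeasure haar
  exact lintegral_sub_left_eq_self ω s

/-- The average over all translates of `ω` of the identity `P₀(A) = ∫_A ξ(ω) P(dξ)`. -/
theorem haar_univ_mul_palm (haar : Measure G) [haar.IsAddHaarMeasure]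
    {P : Measure (LocFinMeasure G)} [SFinite P] (hP : IsStationary P)
    {ω : G → ℝ≥0∞} (hω : Measurable ω) (hω_one : ∫⁻ t, ω t ∂haar = 1)
    {A : Set (LocFinMeasure G)} (hA : MeasurableSet A) (hinv : IsInvariant A) :
    haar univ * palm ω P A = ∫⁻ ξ in A, ξ.toMeasure univ ∂P := by
  have hshift (v : G) :
      palm ω P A = ∫⁻ ξ in A, ∫⁻ t, ω (t - v) ∂ξ.toMeasure ∂P := by
    have hm : Measurable fun ξ : LocFinMeasure G => ∫⁻ t, ω t ∂ξ.toMeasure :=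
      measurable_lintegral_toMeasure measurable_id (hω.comp measurable_snd)
    rw [palm_apply_of_isInvariant hω P hA hinv, ← lintegral_indicator hA,
      ← lintegral_indicator hA, ← hP.lintegral_translate_eq v (hm.indicator hA)]
    refine lintegral_congr fun ξ => ?_
    have hiff := isInvariant_iff.1 hinv v ξ
    by_cases h : ξ ∈ A <;> simp [indicator, hiff, h, lintegral_translate v ξ hω]
  calc haar univ * palm ω P A
      = ∫⁻ v, ∫⁻ ξ in A, ∫⁻ t, ω (t - v) ∂ξ.toMeasure ∂P ∂haar := by
        simp only [← hshift, lintegral_const, mul_comm]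
    _ = ∫⁻ ξ in A, ∫⁻ v, ∫⁻ t, ω (t - v) ∂ξ.toMeasure ∂haar ∂P := by
        refine lintegral_lintegral_swap (Measurable.aemeasurable ?_)
        exact measurable_lintegral_toMeasure (g := fun p : G × LocFinMeasure G => p.2)
          (f := fun p t => ω (t - p.1)) measurable_snd (by unfold Function.uncurry; fun_prop)
    _ = ∫⁻ ξ in A, ξ.toMeasure univ ∂P := by
        refine lintegral_congr fun ξ => ?_
        rw [lintegral_lintegral_swap
          (Measurable.aemeasurable (by unfold Function.uncurry; fun_prop))]
        simp [lintegral_const_sub haar ω, hω_one]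

/-- `P` and its Palm measure have the same invariant null events. -/
theorem palm_eq_zero_iff (haar : Measure G) [haar.IsAddHaarMeasure]
    {P : Measure (LocFinMeasure G)} [SFinite P] (hP : IsStationary P) (hP_zero : P {0} = 0)
    {ω : G → ℝ≥0∞} (hω : Measurable ω) (hω_one : ∫⁻ t, ω t ∂haar = 1)
    {A : Set (LocFinMeasure G)} (hA : MeasurableSet A) (hinv : IsInvariant A) :
    palm ω P A = 0 ↔ P A = 0 := by
  refine ⟨fun h => ?_, fun h => ?_⟩
  · rw [← setLIntegral_toMeasure_univ_eq_zero_iff hP_zero hA,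
      ← haar_univ_mul_palm haar hP hω hω_one hA hinv, h, mul_zero]
  · rw [palm_apply_of_isInvariant hω P hA hinv, setLIntegral_measure_zero A _ h]

/-! ### The exchange formula and the invariance of the Campbell measure -/

/-- The exchange formula: in the integral of `f (τ_u ξ, s - u)` the weight may sit at either of the
two points `s`, `u`. -/
theorem lintegral_exchange (haar : Measure G) [haar.IsAddHaarMeasure]
    {P : Measure (LocFinMeasure G)} [SFinite P] (hP : IsStationary P)
    {ω : G → ℝ≥0∞} (hω : Measurable ω) (hω_one : ∫⁻ t, ω t ∂haar = 1)
    {f : LocFinMeasure G × G → ℝ≥0∞} (hf : Measurable f) :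
    ∫⁻ ξ, ∫⁻ s, ∫⁻ u, ω s * f (translate u ξ, s - u) ∂ξ.toMeasure ∂ξ.toMeasure ∂P
      = ∫⁻ ξ, ∫⁻ s, ∫⁻ u, ω u * f (translate u ξ, s - u) ∂ξ.toMeasure ∂ξ.toMeasure ∂P := by
  have hF : Measurable fun q : LocFinMeasure G × G × G =>
      f (translate q.2.2 q.1, q.2.1 - q.2.2) :=
    hf.comp ((measurable_translate.comp (measurable_fst.prodMk measurable_snd.snd)).prodMk
      (measurable_snd.fst.sub measurable_snd.snd))
  -- `I a b ξ` carries the weight `ω (s + a) * ω (u + b)`.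
  let I : G → G → LocFinMeasure G → ℝ≥0∞ := fun a b ξ =>
    ∫⁻ s, ∫⁻ u, ω (s + a) * ω (u + b) * f (translate u ξ, s - u) ∂ξ.toMeasure ∂ξ.toMeasure
  have hI : Measurable fun p : (G × G) × LocFinMeasure G => I p.1.1 p.1.2 p.2 := by
    refine measurable_lintegral_toMeasure measurable_snd ?_
    refine measurable_lintegral_toMeasure
      (g := fun p : ((G × G) × LocFinMeasure G) × G => p.1.2)
      (f := fun p u => ω (p.2 + p.1.1.1) * ω (u + p.1.1.2)
        * f (translate u p.1.2, p.2 - u)) measurable_fst.snd ?_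
    have h1 : Measurable fun p : (((G × G) × LocFinMeasure G) × G) × G =>
        f (translate p.2 p.1.1.2, p.1.2 - p.2) :=
      hF.comp (measurable_fst.fst.snd.prodMk (measurable_fst.snd.prodMk measurable_snd))
    unfold Function.uncurry
    exact Measurable.mul (by fun_prop) h1
  -- A factor `W v s u` with `∫ W v s u λ(dv) = 1` disappears when `v` is integrated out.
  have hout : ∀ (ξ : LocFinMeasure G) (w : G → G → ℝ≥0∞) (W : G → G → G → ℝ≥0∞),
      (Measurable fun p : G × G => w p.1 p.2) →
      (Measurable fun p : G × G × G => W p.1 p.2.1 p.2.2) →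
      (∀ s u, ∫⁻ v, W v s u ∂haar = 1) →
      ∫⁻ v, ∫⁻ s, ∫⁻ u, W v s u * (w s u * f (translate u ξ, s - u))
          ∂ξ.toMeasure ∂ξ.toMeasure ∂haar
        = ∫⁻ s, ∫⁻ u, w s u * f (translate u ξ, s - u) ∂ξ.toMeasure ∂ξ.toMeasure := by
    intro ξ w W hw hW h1
    have hg : Measurable fun p : G × G => w p.1 p.2 * f (translate p.2 ξ, p.1 - p.2) :=
      hw.mul (hF.comp (measurable_const.prodMk measurable_id))
    have hWg : Measurable fun p : (G × G) × G =>
        W p.1.1 p.1.2 p.2 * (w p.1.2 p.2 * f (translate p.2 ξ, p.1.2 - p.2)) :=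
      (hW.comp (measurable_fst.fst.prodMk (measurable_fst.snd.prodMk measurable_snd))).mul
        (hg.comp (measurable_fst.snd.prodMk measurable_snd))
    rw [lintegral_lintegral_swap (Measurable.lintegral_prod_right' hWg).aemeasurable]
    refine lintegral_congr fun s => ?_
    have hWgs : Measurable fun p : G × G =>
        W p.1 s p.2 * (w s p.2 * f (translate p.2 ξ, s - p.2)) :=
      hWg.comp ((measurable_fst.prodMk measurable_const).prodMk measurable_snd)
    rw [lintegral_lintegral_swap hWgs.aemeasurable]
    refine lintegral_congr fun u => ?_
    have hWsu : Measurable fun v => W v s u :=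
      hW.comp (measurable_id.prodMk (measurable_const (a := (s, u))))
    rw [lintegral_mul_const _ hWsu, h1, one_mul]
  have hplus (u : G) : ∫⁻ v, ω (u + v) ∂haar = 1 := by
    rw [lintegral_add_left_eq_self ω u, hω_one]
  have hminus (s : G) : ∫⁻ v, ω (s - v) ∂haar = 1 := by
    rw [lintegral_const_sub haar ω s, hω_one]
  calc _ = ∫⁻ ξ, ∫⁻ v, I 0 v ξ ∂haar ∂P := by
        refine lintegral_congr fun ξ => ?_
        rw [← hout ξ (fun s _ => ω s) (fun v _ u => ω (u + v)) (by fun_prop) (by fun_prop)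
          fun _ u => hplus u]
        simp only [I, add_zero]
        refine lintegral_congr fun v => lintegral_congr fun s => lintegral_congr fun u => ?_
        ring
    _ = ∫⁻ v, ∫⁻ ξ, I 0 v ξ ∂P ∂haar := by
        refine lintegral_lintegral_swap (Measurable.aemeasurable ?_)
        exact hI.comp ((measurable_const.prodMk measurable_snd).prodMk measurable_fst)
    _ = ∫⁻ v, ∫⁻ ξ, I (-v) 0 ξ ∂P ∂haar := by
        refine lintegral_congr fun v => ?_
        have hI0 : Measurable (I 0 v) :=
          hI.comp ((measurable_const (a := ((0 : G), v))).prodMk measurable_id)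
        rw [← hP.lintegral_translate_eq v hI0]
        refine lintegral_congr fun ξ => ?_
        simp only [I]
        have hF' : Measurable fun p : G × G =>
            ω (p.1 + 0) * ω (p.2 + v) * f (translate p.2 (translate v ξ), p.1 - p.2) :=
          Measurable.mul (by fun_prop) (hF.comp (measurable_const.prodMk measurable_id))
        rw [lintegral_translate v ξ
          (measurable_lintegral_toMeasure (f := fun s u =>
            ω (s + 0) * ω (u + v) * f (translate u (translate v ξ), s - u))
            measurable_const hF')]
        refine lintegral_congr fun s => ?_
        have hFs : Measurable fun u : G => ω (s - v + 0) * ω (u + v)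
            * f (translate u (translate v ξ), s - v - u) :=
          hF'.comp (measurable_const.prodMk measurable_id)
        rw [lintegral_translate v ξ hFs]
        refine lintegral_congr fun u => ?_
        simp [translate_translate, sub_eq_add_neg]
    _ = ∫⁻ ξ, ∫⁻ v, I (-v) 0 ξ ∂haar ∂P := by
        refine lintegral_lintegral_swap (Measurable.aemeasurable ?_)
        exact hI.comp ((measurable_fst.neg.prodMk measurable_const).prodMk measurable_snd)
    _ = _ := by
        refine lintegral_congr fun ξ => ?_
        rw [← hout ξ (fun _ u => ω u) (fun v s _ => ω (s - v)) (by fun_prop) (by fun_prop)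
          fun s _ => hminus s]
        simp only [I, add_zero, sub_eq_add_neg, mul_assoc]

theorem measurable_rho : Measurable (rho : LocFinMeasure G × G → LocFinMeasure G × G) :=
  measurable_translate.prodMk measurable_snd.neg

/-- Integrals of `Q(dξ, dt) = P₀(dξ) ξ(dt)` in terms of `P`. -/
theorem lintegral_campbell_palm {P : Measure (LocFinMeasure G)} [SFinite P]
    {ω : G → ℝ≥0∞} (hω : Measurable ω) {f : LocFinMeasure G × G → ℝ≥0∞} (hf : Measurable f) :
    ∫⁻ p, f p ∂campbell (palm ω P)
      = ∫⁻ ξ, ∫⁻ s, ∫⁻ u, ω s * f (translate s ξ, u - s) ∂ξ.toMeasure ∂ξ.toMeasure ∂P := by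
  have hm : Measurable fun ξ : LocFinMeasure G => ∫⁻ t, f (ξ, t) ∂ξ.toMeasure :=
    measurable_lintegral_toMeasure measurable_id hf
  rw [lintegral_campbell _ hf, lintegral_palm hω P hm]
  refine lintegral_congr fun ξ => lintegral_congr fun s => ?_
  have hfs : Measurable fun t : G => f (translate s ξ, t) :=
    hf.comp (measurable_const.prodMk measurable_id)
  rw [lintegral_translate s ξ hfs]
  exact (lintegral_const_mul _ (hfs.comp (measurable_sub_const s))).symm

theorem measurePreserving_rho (haar : Measure G) [haar.IsAddHaarMeasure]
    {P : Measure (LocFinMeasure G)} [SFinite P] (hP : IsStationary P)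
    {ω : G → ℝ≥0∞} (hω : Measurable ω) (hω_one : ∫⁻ t, ω t ∂haar = 1) :
    MeasurePreserving rho (campbell (palm ω P)) (campbell (palm ω P)) := by
  refine ⟨measurable_rho, Measure.ext_of_lintegral _ fun f hf => ?_⟩
  have hfρ : Measurable fun p => f (rho p) := hf.comp measurable_rho
  rw [lintegral_map hf measurable_rho, lintegral_campbell_palm hω hfρ,
    lintegral_campbell_palm hω hf]
  have h := lintegral_exchange haar hP hω hω_one hf
  simp only [rho, translate_translate, add_sub_cancel, neg_sub]
  rw [h]
  refine lintegral_congr fun ξ => lintegral_lintegral_swap (Measurable.aemeasurable ?_)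
  exact (hω.comp measurable_snd).mul (hf.comp
    ((measurable_translate.comp (measurable_const.prodMk measurable_snd)).prodMk
      (measurable_fst.sub measurable_snd)))

end Palm

end LocFinMeasure

open LocFinMeasure in
theorem mainTheorem3 {G : Type*} [AddCommGroup G] [TopologicalSpace G]
    [IsTopologicalAddGroup G] [LocallyCompactSpace G] [T2Space G] [SecondCountableTopology G]
    [MeasurableSpace G] [BorelSpace G]
    (haar : Measure G) [haar.IsAddHaarMeasure]
    (P : Measure (LocFinMeasure G)) [SigmaFinite P]
    (hP : LocFinMeasure.IsStationary P) (hP_zero : P {0} = 0)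
    (ω : G → ℝ≥0∞) (hω : Measurable ω) (hω_one : ∫⁻ t, ω t ∂haar = 1) :
    List.TFAE [
      LocFinMeasure.IsErgodic P,
      ∀ A : Set (LocFinMeasure G), MeasurableSet A → LocFinMeasure.IsInvariant A →
        LocFinMeasure.palm ω P A = 0 ∨ LocFinMeasure.palm ω P Aᶜ = 0,
      IsErgodicSystem (LocFinMeasure.cylinders G)
        (LocFinMeasure.campbell (LocFinMeasure.palm ω P)) LocFinMeasure.rho] := by
  have hnull {A : Set (LocFinMeasure G)} (hA : MeasurableSet A) (hinv : IsInvariant A) :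
      palm ω P A = 0 ↔ P A = 0 := palm_eq_zero_iff haar hP hP_zero hω hω_one hA hinv
  have hpalm_zero : palm ω P {0} = 0 :=
    (hnull measurableSet_singleton_zero isInvariant_singleton_zero).2 hP_zero
  have hcyl {A : Set (LocFinMeasure G)} (hA : MeasurableSet A) :
      campbell (palm ω P) (A ×ˢ Set.univ) = 0 ↔ palm ω P A = 0 := by
    rw [campbell_prod_univ _ hA, setLIntegral_toMeasure_univ_eq_zero_iff hpalm_zero hA]
  have hcompl (A : Set (LocFinMeasure G)) :
      (A ×ˢ (Set.univ : Set G))ᶜ = Aᶜ ×ˢ Set.univ := by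
    ext p
    simp
  tfae_have 1 ↔ 2 :=
    ⟨fun h A hA hinv => (h.null_or_conull A hA hinv).imp (hnull hA hinv).2
        (hnull hA.compl hinv.compl).2,
      fun h => ⟨hP, fun A hA hinv => (h A hA hinv).imp (hnull hA hinv).1
        (hnull hA.compl hinv.compl).1⟩⟩
  tfae_have 2 → 3 := fun h => by
    refine ⟨measurePreserving_rho haar hP hω hω_one, fun E hE hinv => ?_⟩
    obtain ⟨A, hA, rfl⟩ := measurableSet_cylinders_iff.1 hE
    rw [hcompl]
    exact (h A hA (rho_preimage_prod_univ_eq_iff.1 hinv)).imp (hcyl hA).2 (hcyl hA.compl).2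
  tfae_have 3 → 2 := fun h A hA hinv => by
    have h' := h.null_or_conull (A ×ˢ Set.univ) (measurableSet_cylinders_iff.2 ⟨A, hA, rfl⟩)
      (rho_preimage_prod_univ_eq_iff.2 hinv)
    rw [hcompl] at h'
    exact h'.imp (hcyl hA).1 (hcyl hA.compl).1
  tfae_finish
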